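/- **Theorem 3.2.** Let $\mathbb T^d=\mathbb R^d/\mathbb Z^d$ with Lebesgue measure, let $V:\mathbb T^d\to\mathbb R$ be measurable and bounded, and let $\mathcal H=-\tfrac12\Delta_x+V(x)$, regarded as an unbounded operator on $L^2(\mathbb T^d)$ with domain the set of those $f\in L^2(\mathbb T^d)$ for which $-\tfrac12\Delta f+Vf$, taken in the weak sense, belongs to $L^2(\mathbb T^d)$. Then there is exactly one strongly continuous one-parameter group of unitary operators on $L^2(\mathbb T^d)$ with infinitesimal generator $-\mathrm i\mathcal H$; denote it by $e^{-\mathrm i\mathcal Ht}$, $t\in\mathbb R$. Write $\langle f|g\rangle=\int_{\mathbb T^d}\overline{f(x)}\,g(x)\,dx$. Let $\kappa\in\mathbb R$, let $\psi_1^{in},\dots,\psi_N^{in}:\mathbb T^d\to\mathbb C$, and let $\{\psi_j\}_{j=1}^N$ and $\{\varphi_j\}_{j=1}^N$ be global smooth solutions (continuous on $[0,\infty)\times\mathbb T^d$ and $C^\infty$ on $(0,\infty)\times\mathbb T^d$), with the same initial data $\psi_j|_{t=0}=\varphi_j|_{t=0}=\psi_j^{in}$, of the Schrödinger–Lohe model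 with rotational couplings $$\mathrm i\,\partial_t\psi_j=\mathcal H\psi_j+\frac{\mathrm i\kappa}{N}\sum_{k=1}^N\big(\langle\psi_j|\psi_k\rangle-\langle\psi_k|\psi_j\rangle\big)\psi_j,\qquad t>0,\ x\in\mathbb T^d,$$ and of the corresponding nonlinear system without Hamiltonian $$\mathrm i\,\partial_t\varphi_j=\frac{\mathrm i\kappa}{N}\sum_{k=1}^N\big(\langle\varphi_j|\varphi_k\rangle-\langle\varphi_k|\varphi_j\rangle\big)\varphi_j,\qquad t>0,\ x\in\mathbb T^d,$$ respectively. Then $$\psi_j(t)=e^{-\mathrm i\mathcal Ht}\varphi_j(t)\quad\text{in }L^2(\mathbb T^d),\qquad t\ge 0,\quad j=1,\dots,N.$$ -/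

import Mathlib

open MeasureTheory Set
open scoped ContDiff ComplexConjugate

noncomputable section

namespace SchrodingerLohe

/-- The flat torus `𝕋ᵈ = ℝᵈ / ℤᵈ`. It carries Lebesgue measure `volume`, of total mass one. -/
abbrev Torus (d : ℕ) : Type := UnitAddTorus (Fin d)

/-- The complex Hilbert space `L²(𝕋ᵈ)`. -/
abbrev L2 (d : ℕ) : Type := Lp ℂ 2 (volume : Measure (Torus d))

/-- The projection `ℝᵈ → 𝕋ᵈ`. -/
def proj {d : ℕ} (y : Fin d → ℝ) : Torus d := fun i => (y i : UnitAddCircle)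

/-- A function on the torus is smooth if its periodic lift to `ℝᵈ` is `C^∞`. -/
def IsSmooth {d : ℕ} (f : Torus d → ℂ) : Prop :=
  ContDiff ℝ ∞ (fun y : Fin d → ℝ => f (proj y))

/-- The Laplacian `Δ f (x) = ∑ᵢ d²/ds² f (x + s eᵢ) |_{s = 0}`, for functions of class `C²`. -/
def laplacian {d : ℕ} (f : Torus d → ℂ) (x : Torus d) : ℂ :=
  ∑ i, iteratedDeriv 2 (fun s : ℝ => f (x + proj (Pi.single i s))) 0

/-- The Hamiltonian `H f = - ½ Δ f + V f`, for functions of class `C²`. -/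
def hamiltonian {d : ℕ} (V : Torus d → ℝ) (f : Torus d → ℂ) (x : Torus d) : ℂ :=
  -(1 / 2) * laplacian f x + (V x : ℂ) * f x

/-- The inner product `⟨f | g⟩ = ∫ conj (f x) * g x dx`. -/
def braket {d : ℕ} (f g : Torus d → ℂ) : ℂ := ∫ x, conj (f x) * g x

/-- The graph of the Hamiltonian as an unbounded operator on `L²(𝕋ᵈ)`: `f` lies in the domain and
`H f = g`, where `Δ f` is taken in the weak sense (tested against smooth functions; `V` is real).
For bounded `V` the domain is the Sobolev space `H²(𝕋ᵈ)`. -/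
def HamiltonianGraph {d : ℕ} (V : Torus d → ℝ) (f g : L2 d) : Prop :=
  ∀ η : Torus d → ℂ, IsSmooth η → ∫ x, f x * hamiltonian V η x = ∫ x, g x * η x

/-- `U t = e^{-i H t}`: `U` is the strongly continuous one-parameter group of unitary operators on
`L²(𝕋ᵈ)` whose infinitesimal generator is exactly `-i H` (the domain of `H` is the set of `f` for
which `t ↦ U t f` is differentiable at `0`, and there the derivative is `-i H f`). -/
structure IsUnitaryGroup {d : ℕ} (V : Torus d → ℝ) (U : ℝ → (L2 d ≃ₗᵢ[ℂ] L2 d)) : Prop where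
  map_zero : ∀ f, U 0 f = f
  map_add : ∀ s t f, U (s + t) f = U s (U t f)
  continuous : ∀ f, Continuous (fun t => U t f)
  generator : ∀ f g, HamiltonianGraph V f g ↔ HasDerivAt (fun t => U t f) (-Complex.I • g) 0

/-- The rotational coupling `(i κ / N) ∑ₖ (⟨ψⱼ | ψₖ⟩ - ⟨ψₖ | ψⱼ⟩) ψⱼ`. -/
def coupling {d N : ℕ} (κ : ℝ) (ψ : Fin N → Torus d → ℂ) (j : Fin N) (x : Torus d) : ℂ :=
  Complex.I * κ / N * ∑ k, (braket (ψ j) (ψ k) - braket (ψ k) (ψ j)) * ψ j x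

/-- Space-time regularity of a global smooth solution: continuous on `[0, ∞) × 𝕋ᵈ` and (jointly)
`C^∞` on `(0, ∞) × 𝕋ᵈ`. In particular functions that are `C^∞` up to `t = 0` are included. -/
structure IsGlobalSmooth {d N : ℕ} (ψ : Fin N → ℝ → Torus d → ℂ) : Prop where
  continuousOn : ∀ j, ContinuousOn (fun p : ℝ × Torus d => ψ j p.1 p.2) (Ici 0 ×ˢ univ)
  contDiffOn : ∀ j, ContDiffOn ℝ ∞ (fun p : ℝ × (Fin d → ℝ) => ψ j p.1 (proj p.2))
    (Ioi 0 ×ˢ univ)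

/-- `ψ` is a global smooth solution of the Schrödinger–Lohe model with rotational couplings,
`i ∂ₜ ψⱼ = H ψⱼ + (i κ / N) ∑ₖ (⟨ψⱼ | ψₖ⟩ - ⟨ψₖ | ψⱼ⟩) ψⱼ`, with initial datum `ψ0`. -/
structure IsSolution {d N : ℕ} (V : Torus d → ℝ) (κ : ℝ) (ψ0 : Fin N → Torus d → ℂ)
    (ψ : Fin N → ℝ → Torus d → ℂ) : Prop where
  smooth : IsGlobalSmooth ψ
  initial : ∀ j x, ψ j 0 x = ψ0 j x
  equation : ∀ j, ∀ t > 0, ∀ x, Complex.I * deriv (fun s => ψ j s x) t =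
    hamiltonian V (ψ j t) x + coupling κ (fun k => ψ k t) j x

/-- `φ` is a global smooth solution of the nonlinear system without Hamiltonian,
`i ∂ₜ φⱼ = (i κ / N) ∑ₖ (⟨φⱼ | φₖ⟩ - ⟨φₖ | φⱼ⟩) φⱼ`, with initial datum `ψ0`. -/
structure IsNonlinearSolution {d N : ℕ} (κ : ℝ) (ψ0 : Fin N → Torus d → ℂ)
    (φ : Fin N → ℝ → Torus d → ℂ) : Prop where
  smooth : IsGlobalSmooth φ
  initial : ∀ j x, φ j 0 x = ψ0 j x
  equation : ∀ j, ∀ t > 0, ∀ x, Complex.I * deriv (fun s => φ j s x) t =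
    coupling κ (fun k => φ k t) j x

end SchrodingerLohe

end

/-! The nonlinearity sees the states only through inner products, which unitary operators preserve.
Hence in the interaction picture `χⱼ(t) = U (-t) ψⱼ(t)` the Hamiltonian drops out and the coupling
keeps its form (`loheRate_map`): `χ` solves the same ODE in `L²` as `φ`, with the same initial value
(`IsSolution.hasDerivAt`, `IsNonlinearSolution.hasDerivAt`). The field is cubic, hence Lipschitz on
balls, so `χ = φ` by `loheField_solution_unique`.

Two facts justify the differentiation. Joint smoothness on a compact torus makes the curves
differentiable in the sup norm, hence in `L²` (`exists_hasDerivAt_supCurve`). Green's formula puts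
smooth slices in the weak domain of the Hamiltonian, even for rough bounded `V`
(`hamiltonianGraph_of_isSmooth`).

The group is built in two stages. `-½Δ` is diagonal in the Fourier basis and generates
`diagonalUnitary`; the bounded symmetric potential is then added by a Dyson series
(`exists_perturbation`). The generator is exactly the weak operator because `hamiltonianGraph_iff`
describes the weak graph by Fourier coefficients. For uniqueness, `W (-t) (U t f)` is constant for
`f` in the common domain, which is dense. -/

noncomputable section

namespace SchrodingerLohe

/-! ### Calculus on the torus and symmetry of the Hamiltonian -/

section TorusCalculus

variable {d : ℕ} {f g : Torus d → ℂ}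

theorem isOpenQuotientMap_proj : IsOpenQuotientMap (proj (d := d)) :=
  IsOpenQuotientMap.piMap fun _ => QuotientAddGroup.isOpenQuotientMap_mk

theorem proj_add (x y : Fin d → ℝ) : proj (x + y) = proj x + proj y := by
  ext i; simp [proj]

theorem proj_zero : proj (0 : Fin d → ℝ) = 0 := by
  ext i; simp [proj]

theorem IsSmooth.continuous (hf : IsSmooth f) : Continuous f :=
  isOpenQuotientMap_proj.isQuotientMap.continuous_iff.2 (ContDiff.continuous hf)

/-- The `i`-th partial derivative of a function on the torus. -/
def pderiv (i : Fin d) (f : Torus d → ℂ) (x : Torus d) : ℂ :=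
  deriv (fun s : ℝ => f (x + proj (Pi.single i s))) 0

/-- Translations along one axis form a one-parameter group. This lets the second derivative in
`laplacian` be read as an iterated `pderiv`. -/
theorem deriv_translate (i : Fin d) (f : Torus d → ℂ) (x : Torus d) (s : ℝ) :
    deriv (fun s : ℝ => f (x + proj (Pi.single i s))) s =
      pderiv i f (x + proj (Pi.single i s)) := by
  have h := deriv_comp_const_add (fun s : ℝ => f (x + proj (Pi.single i s))) s 0
  simp only [add_zero] at h
  rw [← h, pderiv]
  congr 1
  ext u
  rw [Pi.single_add, proj_add, add_assoc]

theorem laplacian_eq_sum_pderiv (f : Torus d → ℂ) (x : Torus d) :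
    laplacian f x = ∑ i, pderiv i (pderiv i f) x := by
  refine Finset.sum_congr rfl fun i _ => ?_
  rw [iteratedDeriv_succ, iteratedDeriv_one]
  exact congrArg (deriv · 0) (funext fun s => deriv_translate i f x s)

theorem IsSmooth.contDiff_translate (hf : IsSmooth f) (i : Fin d) (x : Torus d) :
    ContDiff ℝ ∞ (fun s : ℝ => f (x + proj (Pi.single i s))) := by
  obtain ⟨y, rfl⟩ := isOpenQuotientMap_proj.surjective x
  simp only [← proj_add]
  have h2 : ContDiff ℝ ∞ (fun s : ℝ => y + Pi.single (M := fun _ => ℝ) i s) :=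
    contDiff_const.add (ContinuousLinearMap.single ℝ (fun _ : Fin d => ℝ) i).contDiff
  exact ContDiff.comp (g := fun y => f (proj y)) hf h2

theorem IsSmooth.hasDerivAt_translate (hf : IsSmooth f) (i : Fin d) (x : Torus d) (s : ℝ) :
    HasDerivAt (fun s : ℝ => f (x + proj (Pi.single i s)))
      (pderiv i f (x + proj (Pi.single i s))) s := by
  rw [← deriv_translate]
  exact ((hf.contDiff_translate i x).differentiable (by simp)).differentiableAt.hasDerivAt

theorem IsSmooth.hasDerivAt_pderiv (hf : IsSmooth f) (i : Fin d) (x : Torus d) :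
    HasDerivAt (fun s : ℝ => f (x + proj (Pi.single i s))) (pderiv i f x) 0 := by
  simpa [proj_zero] using hf.hasDerivAt_translate i x 0

/-- Passing to the lift turns `pderiv` into a component of a Fréchet derivative, so smoothness is
inherited. -/
theorem pderiv_proj (hf : IsSmooth f) (i : Fin d) (y : Fin d → ℝ) :
    pderiv i f (proj y) = fderiv ℝ (fun y => f (proj y)) y (Pi.single i 1) := by
  have h2 : HasDerivAt (fun s : ℝ => y + Pi.single (M := fun _ => ℝ) i s) (Pi.single i 1) 0 := by
    simpa using (ContinuousLinearMap.single ℝ (fun _ : Fin d => ℝ) i).hasDerivAt.const_add y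
  have h3 : HasFDerivAt (fun y => f (proj y)) (fderiv ℝ (fun y => f (proj y)) y)
      (y + Pi.single (M := fun _ => ℝ) i (0 : ℝ)) := by
    simpa using ((ContDiff.differentiable hf (by simp)) y).hasFDerivAt
  have h1 := h3.comp_hasDerivAt (0 : ℝ) h2
  rw [← h1.deriv, pderiv]
  simp only [← proj_add]
  rfl

theorem IsSmooth.pderiv (hf : IsSmooth f) (i : Fin d) : IsSmooth (pderiv i f) := by
  unfold IsSmooth
  simp only [pderiv_proj hf]
  exact (ContDiff.fderiv_right (m := ∞) hf (by simp)).clm_apply contDiff_const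

theorem IsSmooth.mul (hf : IsSmooth f) (hg : IsSmooth g) : IsSmooth fun x => f x * g x :=
  ContDiff.mul hf hg

theorem IsSmooth.sum {ι : Type*} {s : Finset ι} {F : ι → Torus d → ℂ}
    (hF : ∀ i ∈ s, IsSmooth (F i)) : IsSmooth fun x => ∑ i ∈ s, F i x :=
  ContDiff.sum hF

theorem IsSmooth.laplacian (hf : IsSmooth f) : IsSmooth (laplacian f) := by
  rw [funext (laplacian_eq_sum_pderiv f)]
  exact IsSmooth.sum fun i _ => (hf.pderiv i).pderiv i

theorem pderiv_mul (hf : IsSmooth f) (hg : IsSmooth g) (i : Fin d) (x : Torus d) :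
    pderiv i (fun x => f x * g x) x = pderiv i f x * g x + f x * pderiv i g x := by
  have h := ((hf.hasDerivAt_pderiv i x).mul (hg.hasDerivAt_pderiv i x)).deriv
  simp only [Pi.single_zero, proj_zero, add_zero] at h
  exact h

theorem _root_.Continuous.integrable_torus (hf : Continuous f) : Integrable f := by
  exact (BoundedContinuousFunction.mkOfCompact ⟨f, hf⟩).integrable (volume : Measure (Torus d))

/-- The integral of a partial derivative over the torus vanishes. -/
theorem IsSmooth.integral_pderiv (hf : IsSmooth f) (i : Fin d) : ∫ x, SchrodingerLohe.pderiv i f x = 0 := by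
  have hc := (hf.pderiv i).continuous
  obtain ⟨C, hC⟩ : ∃ C, ∀ x, ‖SchrodingerLohe.pderiv i f x‖ ≤ C := by
    obtain ⟨C, hC⟩ := isCompact_univ.exists_bound_of_continuousOn hc.continuousOn
    exact ⟨C, fun x => hC x (mem_univ x)⟩
  -- Differentiate `s ↦ ∫ f (x + s eᵢ)` under the integral; by translation invariance this function
  -- of `s` is constant.
  have key := (hasDerivAt_integral_of_dominated_loc_of_deriv_le
    (μ := (volume : Measure (Torus d))) (x₀ := (0 : ℝ)) (s := univ) (bound := fun _ => C)
    (F := fun s x => f (x + proj (Pi.single i s)))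
    (F' := fun s x => SchrodingerLohe.pderiv i f (x + proj (Pi.single i s)))
    Filter.univ_mem
    (.of_forall fun s =>
      (hf.continuous.comp (continuous_add_const _)).aestronglyMeasurable)
    (hf.continuous.comp (continuous_add_const _)).integrable_torus
    (hc.comp (continuous_add_const _)).aestronglyMeasurable
    (.of_forall fun x s _ => hC _)
    (integrable_const C)
    (.of_forall fun x s _ => hf.hasDerivAt_translate i x s)).2
  simp only [integral_add_right_eq_self f, Pi.single_zero, proj_zero, add_zero] at key
  exact key.unique (hasDerivAt_const _ _)

theorem integral_pderiv_mul (hf : IsSmooth f) (hg : IsSmooth g) (i : Fin d) :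
    ∫ x, pderiv i f x * g x = -∫ x, f x * pderiv i g x := by
  have h := (hf.mul hg).integral_pderiv i
  simp only [pderiv_mul hf hg] at h
  rw [integral_add] at h
  · exact eq_neg_of_add_eq_zero_left h
  · exact ((hf.pderiv i).continuous.mul hg.continuous).integrable_torus
  · exact (hf.continuous.mul (hg.pderiv i).continuous).integrable_torus

/-- Green's formula on the torus. -/
theorem integral_mul_laplacian (hf : IsSmooth f) (hg : IsSmooth g) :
    ∫ x, f x * laplacian g x = ∫ x, laplacian f x * g x := by
  simp only [laplacian_eq_sum_pderiv, Finset.mul_sum, Finset.sum_mul]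
  rw [integral_finsetSum, integral_finsetSum]
  · refine Finset.sum_congr rfl fun i _ => ?_
    rw [integral_pderiv_mul (hf.pderiv i) hg, 
      integral_pderiv_mul hf (hg.pderiv i), neg_neg]
  · exact fun i _ =>
      (((hf.pderiv i).pderiv i).continuous.mul hg.continuous).integrable_torus
  · exact fun i _ =>
      (hf.continuous.mul ((hg.pderiv i).pderiv i).continuous).integrable_torus

/-- Symmetry of the Hamiltonian, for smooth functions. -/
theorem integral_mul_hamiltonian {V : Torus d → ℝ} (hVm : Measurable V)
    (hVb : ∃ C : ℝ, ∀ x, |V x| ≤ C) (hf : IsSmooth f) (hg : IsSmooth g) :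
    ∫ x, f x * hamiltonian V g x = ∫ x, hamiltonian V f x * g x := by
  obtain ⟨C, hC⟩ := hVb
  have hV : Integrable fun x => (V x : ℂ) * (f x * g x) :=
    (hf.mul hg).continuous.integrable_torus.bdd_mul (c := C)
      (Complex.measurable_ofReal.comp hVm).aestronglyMeasurable
      (.of_forall fun x => by simpa using hC x)
  have h1 : ∀ x, f x * hamiltonian V g x =
      -(1 / 2) * (f x * laplacian g x) + (V x : ℂ) * (f x * g x) := fun x => by
    simp only [hamiltonian]; ring
  have h2 : ∀ x, hamiltonian V f x * g x =
      -(1 / 2) * (laplacian f x * g x) + (V x : ℂ) * (f x * g x) := fun x => by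
    simp only [hamiltonian]; ring
  simp only [h1, h2]
  rw [integral_add _ hV, integral_add _ hV, integral_const_mul, integral_const_mul,
    integral_mul_laplacian hf hg]
  · exact (hf.laplacian.mul hg).continuous.integrable_torus.const_mul _
  · exact (hf.mul hg.laplacian).continuous.integrable_torus.const_mul _

/-! ### Fourier modes as eigenfunctions of the Laplacian -/

theorem fourier_coe (m : ℤ) (y : ℝ) :
    fourier m (y : UnitAddCircle) = Complex.exp (2 * Real.pi * Complex.I * m * y) := by
  simp

theorem isSmooth_mFourier (n : Fin d → ℤ) : IsSmooth (UnitAddTorus.mFourier n) := by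
  unfold IsSmooth
  simp only [UnitAddTorus.mFourier, ContinuousMap.coe_mk, proj, fourier_coe]
  refine contDiff_prod fun i _ => ContDiff.cexp (contDiff_const.mul ?_)
  exact Complex.ofRealCLM.contDiff.comp (contDiff_apply ℝ ℝ i)

theorem mFourier_translate (n : Fin d → ℤ) (x : Torus d) (i : Fin d) (s : ℝ) :
    UnitAddTorus.mFourier n (x + proj (Pi.single i s)) =
      UnitAddTorus.mFourier n x * Complex.exp (2 * Real.pi * Complex.I * n i * s) := by
  simp only [UnitAddTorus.mFourier, ContinuousMap.coe_mk, Pi.add_apply]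
  have h : ∀ j, fourier (n j) (x j + proj (Pi.single i s) j) =
      fourier (n j) (x j) *
        (if j = i then Complex.exp (2 * Real.pi * Complex.I * n i * s) else 1) := fun j => by
    rw [fourier_apply, smul_add, AddCircle.toCircle_add, Circle.coe_mul, ← fourier_apply,
      ← fourier_apply]
    congr 1
    split_ifs with hj
    · subst hj
      simp [proj]
    · simp [proj, Pi.single_eq_of_ne hj]
  simp only [h, Finset.prod_mul_distrib]
  simp

theorem pderiv_const_mul_mFourier (n : Fin d → ℤ) (i : Fin d) (c : ℂ) :
    pderiv i (fun x => c * UnitAddTorus.mFourier n x) =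
      fun x => (c * (2 * Real.pi * Complex.I * n i)) * UnitAddTorus.mFourier n x := by
  ext x
  simp only [pderiv, mFourier_translate]
  have h : HasDerivAt (fun s : ℝ => Complex.exp (2 * Real.pi * Complex.I * n i * s))
      (2 * Real.pi * Complex.I * n i) 0 := by
    have h0 := ((Complex.ofRealCLM.hasDerivAt (x := (0 : ℝ))).const_mul
      (2 * Real.pi * Complex.I * n i)).cexp
    simpa using h0
  rw [((h.const_mul _).const_mul c).deriv]
  ring

/-- The eigenvalue of `- ½ Δ` at the Fourier mode `n`. -/
def freq (n : Fin d → ℤ) : ℝ := 2 * Real.pi ^ 2 * ∑ i, (n i : ℝ) ^ 2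

theorem freq_neg (n : Fin d → ℤ) : freq (-n) = freq n := by simp [freq]

theorem laplacian_mFourier (n : Fin d → ℤ) (x : Torus d) :
    -(1 / 2) * laplacian (UnitAddTorus.mFourier n) x = freq n * UnitAddTorus.mFourier n x := by
  have h : ∀ i, pderiv i (pderiv i (UnitAddTorus.mFourier n)) x =
      (2 * Real.pi * Complex.I * n i) ^ 2 * UnitAddTorus.mFourier n x := fun i => by
    have h1 := pderiv_const_mul_mFourier n i 1
    simp only [one_mul] at h1
    rw [h1, pderiv_const_mul_mFourier, sq]
  simp only [laplacian_eq_sum_pderiv, h, freq]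
  push_cast
  simp only [Finset.mul_sum, Finset.sum_mul]
  refine Finset.sum_congr rfl fun i _ => ?_
  simp only [mul_pow, Complex.I_sq]
  ring

end TorusCalculus

/-! ### Linear equations with bounded time-dependent coefficients -/

section LinearODE

open Filter Topology Interval

variable {E : Type*} [NormedAddCommGroup E] [NormedSpace ℝ E]

/-- The terms of the Dyson series of the linear equation `y' = A(t) y`. -/
def dysonTerm (A : ℝ → E → E) (x : E) : ℕ → ℝ → E
  | 0 => fun _ => x
  | n + 1 => fun t => ∫ s in (0 : ℝ)..t, A s (dysonTerm A x n s)

variable {A : ℝ → E → E} {C : ℝ}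

theorem continuous_dysonTerm (hA : Continuous fun p : ℝ × E => A p.1 p.2) (x : E) :
    ∀ n, Continuous (dysonTerm A x n)
  | 0 => continuous_const
  | n + 1 => by
    have h : Continuous fun s => A s (dysonTerm A x n s) :=
      hA.comp (continuous_id.prodMk (continuous_dysonTerm hA x n))
    exact intervalIntegral.continuous_primitive (fun a b => h.intervalIntegrable a b) 0

theorem hasDerivAt_dysonTerm [CompleteSpace E] (hA : Continuous fun p : ℝ × E => A p.1 p.2) (x : E) (n : ℕ)
    (t : ℝ) : HasDerivAt (dysonTerm A x (n + 1)) (A t (dysonTerm A x n t)) t := by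
  have h : Continuous fun s => A s (dysonTerm A x n s) :=
    hA.comp (continuous_id.prodMk (continuous_dysonTerm hA x n))
  exact intervalIntegral.integral_hasDerivAt_right (h.intervalIntegrable 0 t)
    (h.stronglyMeasurableAtFilter _ _) h.continuousAt

/-- Each integration turns `|s| ^ n` into `|t| ^ (n + 1) / (n + 1)`, which builds up the factorial.
The unordered interval treats both signs of `t` at once. -/
theorem norm_dysonTerm_le (hA : Continuous fun p : ℝ × E => A p.1 p.2) (hC : 0 ≤ C)
    (hb : ∀ t x, ‖A t x‖ ≤ C * ‖x‖) (x : E) :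
    ∀ (n : ℕ) (t : ℝ), ‖dysonTerm A x n t‖ ≤ ‖x‖ * ((C * |t|) ^ n / n.factorial)
  | 0, t => by simp [dysonTerm]
  | n + 1, t => by
    have h : Continuous fun s => A s (dysonTerm A x n s) :=
      hA.comp (continuous_id.prodMk (continuous_dysonTerm hA x n))
    calc ‖dysonTerm A x (n + 1) t‖
        ≤ ∫ s in Ι (0 : ℝ) t, ‖A s (dysonTerm A x n s)‖ :=
          intervalIntegral.norm_integral_le_integral_norm_uIoc
      _ ≤ ∫ s in Ι (0 : ℝ) t, ‖x‖ * C ^ (n + 1) / n.factorial * |s - 0| ^ n := by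
          refine setIntegral_mono (h.norm.integrableOn_uIoc) ?_ fun s => ?_
          · exact Continuous.integrableOn_uIoc (by fun_prop)
          · refine (hb _ _).trans ((mul_le_mul_of_nonneg_left
              (norm_dysonTerm_le hA hC hb x n s) hC).trans_eq ?_)
            rw [sub_zero, mul_pow, pow_succ]
            ring
      _ = _ := by
          rw [integral_const_mul, integral_pow_abs_sub_uIoc, sub_zero, Nat.factorial_succ,
            mul_pow]
          push_cast
          field_simp

/-- A linear differential equation `y' = A(t) y` whose right-hand side is continuous and bounded by
`C ‖y‖` has a global solution. -/
theorem exists_linear_ode_solution [CompleteSpace E] {A : ℝ → E →L[ℝ] E}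
    (hA : Continuous fun p : ℝ × E => A p.1 p.2) (hC : 0 ≤ C)
    (hb : ∀ t x, ‖A t x‖ ≤ C * ‖x‖) (x : E) :
    ∃ y : ℝ → E, y 0 = x ∧ ∀ t, HasDerivAt y (A t (y t)) t := by
  let D : ℕ → ℝ → E := dysonTerm (fun t x => A t x) x
  have hD := norm_dysonTerm_le (A := fun t x => A t x) hA hC hb x
  have hsum : ∀ t, Summable fun n => D n t := fun t =>
    .of_norm_bounded ((Real.summable_pow_div_factorial (C * |t|)).mul_left ‖x‖) fun n => hD n t
  -- The constant zeroth term is split off because differentiation lowers the index: `D (n + 1)` has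
  -- derivative `A t (D n t)`.
  have hsplit : ∀ t, ∑' n, D n t = x + ∑' n, D (n + 1) t := fun t => by
    rw [(hsum t).tsum_eq_zero_add]; rfl
  have hzero : ∀ n, D (n + 1) 0 = 0 := fun n => by simp [D, dysonTerm]
  refine ⟨fun t => ∑' n, D n t, ?_, fun t => ?_⟩
  · simp [hsplit, hzero]
  · have hder : HasDerivAt (fun t => ∑' n, D (n + 1) t) (∑' n, A t (D n t)) t := by
      refine hasDerivAt_tsum_of_isPreconnected
        (u := fun n => C * (‖x‖ * ((C * (|t| + 1)) ^ n / n.factorial)))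
        (g := fun n t => D (n + 1) t) (t := Metric.ball 0 (|t| + 1)) (y₀ := 0) ?_ Metric.isOpen_ball
        (convex_ball _ _).isPreconnected
        (fun n s _ => hasDerivAt_dysonTerm (A := fun t x => A t x) hA x n s) (fun n s hs => ?_)
        (by simp; positivity) (by simp [hzero]) (by simp)
      · exact ((Real.summable_pow_div_factorial _).mul_left _).mul_left _
      · refine (hb _ _).trans (mul_le_mul_of_nonneg_left ((hD n s).trans ?_) hC)
        have : |s| ≤ |t| + 1 := by simpa using (Metric.mem_ball.1 hs).le
        gcongr
    rw [← (A t).map_tsum (hsum t)] at hder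
    exact (hder.const_add x).congr_of_eventuallyEq (.of_forall hsplit)

theorem linear_ode_unique {A : ℝ → E →L[ℝ] E} (hC : 0 ≤ C)
    (hb : ∀ t x, ‖A t x‖ ≤ C * ‖x‖) {y z : ℝ → E} (hy : ∀ t, HasDerivAt y (A t (y t)) t)
    (hz : ∀ t, HasDerivAt z (A t (z t)) t) (h0 : y 0 = z 0) : y = z :=
  ODE_solution_unique_univ (v := fun t x => A t x) (s := fun _ => univ) (K := ⟨C, hC⟩) (t₀ := 0)
    (fun t => ((A t).lipschitz.weaken
      ((A t).opNorm_le_bound hC (hb t) : ‖A t‖ ≤ C)).lipschitzOnWith)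
    (fun t => ⟨hy t, mem_univ _⟩) (fun t => ⟨hz t, mem_univ _⟩) h0

end LinearODE

/-! ### Unitary groups and bounded perturbations -/

section UnitaryGroups

open Filter Topology

variable {E : Type*} [NormedAddCommGroup E] [InnerProductSpace ℂ E]

/-- A strongly continuous one-parameter group of unitary operators. -/
structure IsStrongGroup (U : ℝ → (E ≃ₗᵢ[ℂ] E)) : Prop where
  zero_apply : ∀ f, U 0 f = f
  add_apply : ∀ s t f, U (s + t) f = U s (U t f)
  continuous : ∀ f, Continuous (fun t => U t f)

namespace IsStrongGroup

variable {U : ℝ → (E ≃ₗᵢ[ℂ] E)}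

theorem apply_neg_self (hU : IsStrongGroup U) (t : ℝ) (f : E) : U t (U (-t) f) = f := by
  rw [← hU.add_apply, add_neg_cancel, hU.zero_apply]

/-- Isometries are equally Lipschitz, so strong continuity upgrades to joint continuity. -/
theorem continuous_uncurry (hU : IsStrongGroup U) : Continuous fun p : ℝ × E => U p.1 p.2 :=
  continuous_prod_of_continuous_lipschitzWith' _ 1 (fun t => (U t).lipschitz) hU.continuous

/-- Product rule for a unitary group acting on a curve. -/
theorem hasDerivAt_apply (hU : IsStrongGroup U) {s : ℝ → ℝ} {u : ℝ → E} {u' w : E} {t : ℝ}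
    (hs : ContinuousAt s t) (hu : HasDerivAt u u' t)
    (hw : HasDerivAt (fun τ => U (s τ) (u t)) w t) :
    HasDerivAt (fun τ => U (s τ) (u τ)) (w + U (s t) u') t := by
  rw [hasDerivAt_iff_tendsto_slope] at hu hw ⊢
  have h1 : Tendsto (fun τ => U (s τ) (slope u t τ)) (𝓝[≠] t) (𝓝 (U (s t) u')) :=
    (hU.continuous_uncurry.tendsto (s t, u')).comp
      ((hs.tendsto.mono_left nhdsWithin_le_nhds).prodMk_nhds hu)
  refine (hw.add h1).congr fun τ => ?_
  simp only [slope_def_module]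
  rw [show U (s τ) ((τ - t)⁻¹ • (u τ - u t)) = (τ - t)⁻¹ • U (s τ) (u τ - u t) from
    (U (s τ)).toLinearEquiv.toLinearMap.map_smul_of_tower _ _, map_sub, ← smul_add]
  congr 1
  abel

theorem hasDerivAt_of_zero (hU : IsStrongGroup U) {f w : E}
    (h : HasDerivAt (fun τ => U τ f) w 0) (t : ℝ) : HasDerivAt (fun τ => U τ f) (U t w) t := by
  have h1 : HasDerivAt (fun τ => U (τ - t) f) w t := by
    exact HasDerivAt.comp_sub_const (f := fun τ => U τ f) t t (by simpa using h)
  have h2 := ((U t).toContinuousLinearEquiv.toContinuousLinearMap.restrictScalars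
    ℝ).hasFDerivAt.comp_hasDerivAt t h1
  refine h2.congr_of_eventuallyEq (.of_forall fun τ => ?_)
  change U τ f = U t (U (τ - t) f)
  rw [← hU.add_apply, add_sub_cancel]

/-- The derivative of `U(-t) u(t)`, when `u` takes values in the domain of the generator. -/
theorem hasDerivAt_neg_apply (hU : IsStrongGroup U) {u : ℝ → E} {u' w : E} {t : ℝ}
    (hu : HasDerivAt u u' t) (hw : HasDerivAt (fun τ => U τ (u t)) w 0) :
    HasDerivAt (fun τ => U (-τ) (u τ)) (U (-t) (u' - w)) t := by
  have h1 : HasDerivAt (fun τ => U (-τ) (u t)) (-(U (-t) w)) t := by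
    rw [← neg_one_smul ℝ]
    exact (hU.hasDerivAt_of_zero hw (-t)).scomp t (hasDerivAt_neg t)
  have h2 := hU.hasDerivAt_apply continuous_neg.continuousAt hu h1
  rwa [neg_add_eq_sub, ← map_sub] at h2

variable [CompleteSpace E]

/-- Perturbation of a unitary group by a bounded symmetric operator. -/
theorem exists_perturbation (hU : IsStrongGroup U) (B : E →L[ℂ] E)
    (hB : ∀ x y, inner ℂ (B x) y = inner ℂ x (B y)) :
    ∃ W : ℝ → (E ≃ₗᵢ[ℂ] E), IsStrongGroup W ∧ ∀ f g,
      HasDerivAt (fun t => W t f) (-Complex.I • g) 0 ↔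
        HasDerivAt (fun t => U t f) (-Complex.I • (g - B f)) 0 := by
  -- The perturbation in the interaction picture, `-i U(-t) B U(t)`. If `y' = A y`, then `U t (y t)`
  -- formally solves the perturbed equation, and the unbounded generator never appears.
  let A : ℝ → E →L[ℝ] E := fun t =>
    ((-Complex.I) • ((U (-t)).toContinuousLinearEquiv.toContinuousLinearMap ∘L B ∘L
      (U t).toContinuousLinearEquiv.toContinuousLinearMap)).restrictScalars ℝ
  have hAdef : ∀ t x, A t x = -Complex.I • U (-t) (B (U t x)) := fun t x => rfl
  have hAc : Continuous fun p : ℝ × E => A p.1 p.2 := by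
    simp only [hAdef]
    exact (hU.continuous_uncurry.comp (continuous_fst.neg.prodMk
      (B.continuous.comp hU.continuous_uncurry))).const_smul _
  have hAb : ∀ t x, ‖A t x‖ ≤ ‖B‖ * ‖x‖ := fun t x => by
    rw [hAdef, norm_smul, LinearIsometryEquiv.norm_map]
    simpa using B.le_opNorm (U t x)
  -- Symmetry of `B` makes `A t` skew-adjoint, so solutions have constant norm.
  have hA0 : ∀ t x, inner ℂ x (A t x) + inner ℂ (A t x) x = 0 := fun t x => by
    have h1 : inner ℂ x (U (-t) (B (U t x))) = inner ℂ (U t x) (B (U t x)) := by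
      rw [← (U t).inner_map_map, hU.apply_neg_self]
    have h2 : inner ℂ (U (-t) (B (U t x))) x = inner ℂ (U t x) (B (U t x)) := by
      rw [← hB, ← (U t).inner_map_map, hU.apply_neg_self]
    rw [hAdef, inner_smul_left, inner_smul_right, h1, h2]
    simp
  choose y hy0 hy using exists_linear_ode_solution hAc (norm_nonneg B) hAb
  have huniq : ∀ (f : E) (z : ℝ → E), z 0 = f → (∀ t, HasDerivAt z (A t (z t)) t) → z = y f :=
    fun f z hz0 hz => linear_ode_unique (norm_nonneg B) hAb hz (hy f) (hz0.trans (hy0 f).symm)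
  have hnorm : ∀ f t, ‖y f t‖ = ‖f‖ := fun f t => by
    have hd : ∀ t, HasDerivAt (fun t => inner ℂ (y f t) (y f t)) 0 t := fun t => by
      simpa only [hA0] using (hy f t).inner ℂ (hy f t)
    have hc := is_const_of_deriv_eq_zero (fun t => (hd t).differentiableAt)
      (fun t => (hd t).deriv) t 0
    simp only [inner_self_eq_norm_sq_to_K, hy0] at hc
    have hc' : ‖y f t‖ ^ 2 = ‖f‖ ^ 2 := by exact_mod_cast hc
    exact (sq_eq_sq₀ (norm_nonneg _) (norm_nonneg _)).1 hc'
  have hadd : ∀ f g t, y (f + g) t = y f t + y g t := fun f g t => by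
    have h := huniq (f + g) (fun t => y f t + y g t) (by simp [hy0]) fun t => by
      rw [map_add]; exact (hy f t).add (hy g t)
    exact (congrFun h t).symm
  have hsmul : ∀ (c : ℂ) f t, y (c • f) t = c • y f t := fun c f t => by
    have h := huniq (c • f) (fun t => c • y f t) (by simp [hy0]) fun t => by
      have h1 : A t (c • y f t) = c • A t (y f t) := by
        simp only [hAdef, map_smul, smul_comm c]
      rw [h1]; exact (hy f t).const_smul c
    exact (congrFun h t).symm
  -- The group law comes from ODE uniqueness and the covariance `A s ∘ U t = U t ∘ A (s + t)`.
  have hgroup : ∀ s t f, U (s + t) (y f (s + t)) = U s (y (U t (y f t)) s) := fun s t f => by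
    have h := huniq (U t (y f t)) (fun s => U t (y f (s + t))) (by simp) fun s => by
      have h1 : A s (U t (y f (s + t))) = U t (A (s + t) (y f (s + t))) := by
        rw [hAdef, hAdef, map_smul, ← hU.add_apply, ← hU.add_apply]
        congr 3
        ring
      rw [h1]
      exact ((U t).toContinuousLinearEquiv.toContinuousLinearMap.restrictScalars
        ℝ).hasFDerivAt.comp_hasDerivAt s ((hy f (s + t)).comp_add_const s t)
    rw [← congrFun h s, ← hU.add_apply]
  let W₀ : ℝ → (E →ₗᵢ[ℂ] E) := fun t =>
    { toFun := fun f => U t (y f t)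
      map_add' := fun f g => by rw [hadd, map_add]
      map_smul' := fun c f => by rw [hsmul, map_smul, RingHom.id_apply]
      norm_map' := fun f => ((U t).norm_map _).trans (hnorm f t) }
  have hsurj : ∀ t, Function.Surjective (W₀ t) := fun t g => by
    refine ⟨U (-t) (y g (-t)), ?_⟩
    have h := hgroup t (-t) g
    rw [add_neg_cancel, hy0, hU.zero_apply] at h
    exact h.symm
  refine ⟨fun t => LinearIsometryEquiv.ofSurjective (W₀ t) (hsurj t),
    ⟨fun f => ?_, fun s t f => hgroup s t f, fun f => ?_⟩, fun f g => ?_⟩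
  · change U 0 (y f 0) = f
    rw [hy0, hU.zero_apply]
  · change Continuous fun t => U t (y f t)
    exact hU.continuous_uncurry.comp (continuous_id.prodMk
      (continuous_iff_continuousAt.2 fun t => (hy f t).continuousAt))
  · change HasDerivAt (fun t => U t (y f t)) _ 0 ↔ _
    -- The difference of the two orbits is differentiable at `0` for every `f`; hence the two
    -- generators have the same domain.
    have h0 : HasDerivAt (fun t => U t (y f t - f)) (-Complex.I • B f) 0 := by
      have h1 := hU.hasDerivAt_apply (s := fun t => t) (w := 0) continuousAt_id
        ((hy f 0).sub_const f) (by simpa [hy0] using hasDerivAt_const (0 : ℝ) (0 : E))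
      simpa [hy0, hAdef, hU.zero_apply] using h1
    constructor
    · intro h
      convert! h.sub h0 using 1
      · ext t; simp
      · rw [smul_sub]
    · intro h
      convert! h.add h0 using 1
      · ext t; simp
      · rw [smul_sub, sub_add_cancel]

end IsStrongGroup

end UnitaryGroups

/-! ### Diagonal unitary groups in a Hilbert basis -/

section DiagonalGroup

open Filter Topology

variable {ι E : Type*} [NormedAddCommGroup E] [InnerProductSpace ℂ E] (b : HilbertBasis ι ℂ E)

theorem _root_.HilbertBasis.hasSum_norm_sq_repr (x : E) :
    HasSum (fun i => ‖b.repr x i‖ ^ 2) (‖x‖ ^ 2) := by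
  have h := lp.hasSum_norm (p := 2) (by simp) (b.repr x)
  simpa using h

/-- Parseval turns the squared distance into a series, to which dominated convergence applies. -/
theorem _root_.HilbertBasis.tendsto_of_repr {α : Type*} {l : Filter α} {F : α → E} {x : E}
    {bound : ι → ℝ} (hs : Summable bound)
    (hF : ∀ i, Tendsto (fun a => b.repr (F a) i) l (𝓝 (b.repr x i)))
    (hb : ∀ a i, ‖b.repr (F a) i - b.repr x i‖ ^ 2 ≤ bound i) : Tendsto F l (𝓝 x) := by
  have h1 : Tendsto (fun a => ∑' i, ‖b.repr (F a) i - b.repr x i‖ ^ 2) l (𝓝 (∑' _ : ι, 0)) := by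
    refine tendsto_tsum_of_dominated_convergence hs (fun i => ?_) (.of_forall fun a i => ?_)
    · have := ((hF i).sub_const (b.repr x i)).norm.pow 2
      simpa using this
    · simpa using hb a i
  have h2 : ∀ a, ∑' i, ‖b.repr (F a) i - b.repr x i‖ ^ 2 = ‖F a - x‖ ^ 2 := fun a => by
    rw [← (b.hasSum_norm_sq_repr (F a - x)).tsum_eq]
    simp
  simp only [h2, tsum_zero] at h1
  rw [tendsto_iff_norm_sub_tendsto_zero]
  have h3 := h1.sqrt
  simpa [Real.sqrt_sq] using h3

theorem norm_phase (θ : ℝ) : ‖Complex.exp (Complex.I * θ)‖ = 1 := by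
  rw [mul_comm, Complex.norm_exp_ofReal_mul_I]

theorem orthonormal_phase_smul (θ : ι → ℝ) :
    Orthonormal ℂ fun i => Complex.exp (Complex.I * θ i) • b i := by
  classical
  rw [orthonormal_iff_ite]
  intro i j
  rw [inner_smul_left, inner_smul_right, orthonormal_iff_ite.1 b.orthonormal i j]
  split_ifs with h
  · subst h
    rw [mul_one, ← Complex.normSq_eq_conj_mul_self, Complex.normSq_eq_norm_sq, norm_phase]
    simp
  · simp

/-- The unitary operator which multiplies the `i`-th coefficient by `e^{-i θᵢ}`. -/
def diagonalUnitary [CompleteSpace E] (θ : ι → ℝ) : E ≃ₗᵢ[ℂ] E :=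
  -- Coordinates in the rotated basis pick up the conjugate phase, whence the minus sign in `e^{-i
  -- θᵢ}`.
  (HilbertBasis.mk (orthonormal_phase_smul b θ) (by
    rw [← b.dense_span]
    refine Submodule.topologicalClosure_mono (Submodule.span_le.2 ?_)
    rintro _ ⟨i, rfl⟩
    have h := Submodule.smul_mem (Submodule.span ℂ
      (range fun i => Complex.exp (Complex.I * θ i) • b i)) (Complex.exp (Complex.I * θ i))⁻¹
      (Submodule.subset_span (mem_range_self i))
    simp only [smul_smul, inv_mul_cancel₀ (Complex.exp_ne_zero _), one_smul] at h
    exact h)).repr.trans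
  b.repr.symm

theorem repr_diagonalUnitary [CompleteSpace E] (θ : ι → ℝ) (x : E) (i : ι) :
    b.repr (diagonalUnitary b θ x) i = Complex.exp (-(Complex.I * θ i)) * b.repr x i := by
  rw [diagonalUnitary, LinearIsometryEquiv.trans_apply, LinearIsometryEquiv.apply_symm_apply,
    HilbertBasis.repr_apply_apply, HilbertBasis.coe_mk, inner_smul_left, b.repr_apply_apply,
    ← Complex.exp_conj]
  simp

theorem _root_.HilbertBasis.ext_repr {x y : E} (h : ∀ i, b.repr x i = b.repr y i) : x = y :=
  b.repr.injective (lp.ext (funext h))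

theorem isStrongGroup_diagonalUnitary [CompleteSpace E] (w : ι → ℝ) :
    IsStrongGroup fun t => diagonalUnitary b fun i => w i * t where
  zero_apply f := b.ext_repr fun i => by simp [repr_diagonalUnitary]
  add_apply s t f := b.ext_repr fun i => by
    simp only [repr_diagonalUnitary, ← mul_assoc, ← Complex.exp_add]
    congr 2
    push_cast
    ring
  continuous f := continuous_iff_continuousAt.2 fun t => by
    refine b.tendsto_of_repr ((b.hasSum_norm_sq_repr f).summable.mul_left 4) (fun i => ?_)
      fun s i => ?_
    · simp only [repr_diagonalUnitary]
      exact Continuous.tendsto (by fun_prop) t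
    · have h : ∀ s : ℝ, ‖Complex.exp (-(Complex.I * (w i * s : ℝ)))‖ = 1 := fun s => by
        rw [← mul_neg, ← Complex.ofReal_neg, norm_phase]
      simp only [repr_diagonalUnitary]
      rw [← sub_mul, norm_mul, mul_pow]
      gcongr
      calc _ ≤ (1 + 1 : ℝ) ^ 2 := by
            gcongr
            exact (norm_sub_le _ _).trans (by rw [h, h])
        _ = 4 := by norm_num

/-- A derivative in norm gives one in each coordinate. Conversely `|e^{iθ} - 1| ≤ |θ|` bounds the
squared error in each coordinate by `4 |hᵢ|²`, which is summable, so no domain condition beyond `h ∈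
E` is needed. -/
theorem hasDerivAt_diagonalUnitary_iff [CompleteSpace E] (w : ι → ℝ) (f h : E) :
    HasDerivAt (fun t => diagonalUnitary b (fun i => w i * t) f) (-Complex.I • h) 0 ↔
      ∀ i, w i * b.repr f i = b.repr h i := by
  have hexp : ∀ i, HasDerivAt (fun t : ℝ => Complex.exp (-(Complex.I * (w i * t : ℝ))))
      (-(Complex.I * w i)) 0 := fun i => by
    have h0 := ((Complex.ofRealCLM.hasDerivAt (x := (0 : ℝ))).const_mul
      (-(Complex.I * w i))).cexp
    simp only [Complex.ofRealCLM_apply, Complex.ofReal_zero, mul_zero, Complex.exp_zero, one_mul,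
      Complex.ofReal_one, mul_one] at h0
    refine h0.congr_of_eventuallyEq (.of_forall fun t => ?_)
    simp only [Complex.ofReal_mul]
    congr 1
    ring
  have hcoef : ∀ i, HasDerivAt
      (fun t => b.repr (diagonalUnitary b (fun i => w i * t) f) i)
      (-(Complex.I * w i) * b.repr f i) 0 := fun i => by
    simp only [repr_diagonalUnitary]
    exact (hexp i).mul_const _
  constructor
  · intro hd i
    have h1 : HasDerivAt (fun t => b.repr (diagonalUnitary b (fun i => w i * t) f) i)
        (b.repr (-Complex.I • h) i) 0 := by
      simp only [b.repr_apply_apply]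
      exact ((innerSL ℂ (b i)).restrictScalars ℝ).hasFDerivAt.comp_hasDerivAt 0 hd
    have h2 := (hcoef i).unique h1
    rw [map_smul, lp.coeFn_smul, Pi.smul_apply, smul_eq_mul, neg_mul, neg_mul, neg_inj,
      mul_assoc] at h2
    exact mul_left_cancel₀ Complex.I_ne_zero h2
  · intro hfh
    rw [hasDerivAt_iff_tendsto_slope_zero]
    refine b.tendsto_of_repr ((b.hasSum_norm_sq_repr h).summable.mul_left 4) (fun i => ?_)
      fun t i => ?_
    · have h1 := hasDerivAt_iff_tendsto_slope_zero.1 (hcoef i)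
      have h2 : b.repr (-Complex.I • h) i = -(Complex.I * w i) * b.repr f i := by
        rw [map_smul, lp.coeFn_smul, Pi.smul_apply, smul_eq_mul, ← hfh i]
        ring
      rw [h2]
      refine h1.congr fun t => ?_
      rw [← Complex.coe_smul, ← Complex.coe_smul, map_smul, map_sub]
      rfl
    · have h1 : ‖(t⁻¹ : ℂ) * (Complex.exp (-(Complex.I * (w i * t : ℝ))) - 1)‖ ≤ |w i| := by
        rcases eq_or_ne t 0 with rfl | ht
        · simp
        rw [norm_mul, norm_inv, Complex.norm_real, Real.norm_eq_abs,
          inv_mul_le_iff₀ (abs_pos.2 ht), ← mul_neg, ← Complex.ofReal_neg]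
        refine Real.norm_exp_I_mul_ofReal_sub_one_le.trans_eq ?_
        rw [norm_neg, Real.norm_eq_abs, abs_mul, mul_comm]
      have h2 : b.repr (t⁻¹ • (diagonalUnitary b (fun i => w i * (0 + t)) f -
          diagonalUnitary b (fun i => w i * 0) f)) i - b.repr (-Complex.I • h) i =
          ((t⁻¹ : ℂ) * (Complex.exp (-(Complex.I * (w i * t : ℝ))) - 1) + Complex.I * w i) *
            b.repr f i := by
        rw [← Complex.coe_smul, map_smul, map_smul, map_sub]
        simp only [lp.coeFn_smul, lp.coeFn_sub, Pi.smul_apply, Pi.sub_apply, smul_eq_mul,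
          repr_diagonalUnitary, ← hfh i]
        simp
        ring
      rw [h2, norm_mul, ← hfh i, norm_mul, mul_pow, mul_pow, ← mul_assoc]
      gcongr
      calc _ ≤ (|w i| + |w i|) ^ 2 := by
            gcongr
            exact (norm_add_le _ _).trans (add_le_add h1 (by simp))
        _ = 4 * ‖(w i : ℂ)‖ ^ 2 := by
            rw [Complex.norm_real, Real.norm_eq_abs]
            ring

end DiagonalGroup

/-! ### Existence and uniqueness of the Schrödinger group -/

section HamiltonianGroup

variable {d : ℕ}

/-- The measure is a variable so that `subst` can transport the basis across an equality of measures
inside the type `Lp ℂ 2 μ`. -/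
theorem exists_fourier_hilbertBasis_of_eq (μ : Measure (Torus d))
    (hμ : μ = Measure.pi fun _ => AddCircle.haarAddCircle) :
    ∃ b : HilbertBasis (Fin d → ℤ) ℂ (Lp ℂ 2 μ), ∀ n, b n =ᵐ[μ] UnitAddTorus.mFourier n := by
  subst hμ
  refine ⟨UnitAddTorus.mFourierBasis, fun n => ?_⟩
  have h := UnitAddTorus.coeFn_mFourierLp (d := Fin d) 2 n
  rw [← UnitAddTorus.coe_mFourierBasis] at h
  exact h

theorem exists_fourier_hilbertBasis (d : ℕ) :
    ∃ b : HilbertBasis (Fin d → ℤ) ℂ (L2 d), ∀ n, b n =ᵐ[volume] UnitAddTorus.mFourier n := by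
  refine exists_fourier_hilbertBasis_of_eq _ ?_
  rw [volume_pi]
  congr 1
  ext1 i
  rw [AddCircle.volume_eq_smul_haarAddCircle]
  simp

/-- The orthonormal basis of `L²(𝕋ᵈ)` formed by the Fourier modes. -/
def fourierBasis (d : ℕ) : HilbertBasis (Fin d → ℤ) ℂ (L2 d) :=
  (exists_fourier_hilbertBasis d).choose

theorem coeFn_fourierBasis (n : Fin d → ℤ) :
    fourierBasis d n =ᵐ[volume] UnitAddTorus.mFourier n :=
  (exists_fourier_hilbertBasis d).choose_spec n

theorem fourierBasis_repr (f : L2 d) (n : Fin d → ℤ) :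
    (fourierBasis d).repr f n = ∫ x, f x * UnitAddTorus.mFourier (-n) x := by
  rw [HilbertBasis.repr_apply_apply, L2.inner_def]
  refine integral_congr_ae ?_
  filter_upwards [coeFn_fourierBasis n] with x hx
  rw [RCLike.inner_apply, hx, UnitAddTorus.mFourier_neg]

theorem integrable_L2_mul (f : L2 d) {k : Torus d → ℂ} (hk : Continuous k) :
    Integrable fun x => f x * k x := by
  obtain ⟨C, hC⟩ := isCompact_univ.exists_bound_of_continuousOn hk.continuousOn
  exact ((Lp.memLp f).integrable (by norm_num)).mul_bdd hk.aestronglyMeasurable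
    (.of_forall fun x => hC x (mem_univ x))

/-- Parseval for the bilinear pairing: the weak equation against an arbitrary test function reduces
to its Fourier modes. -/
theorem hasSum_integral_mul_repr (f : L2 d) {k : Torus d → ℂ} (hk : Continuous k) :
    HasSum (fun n => (fourierBasis d).repr f n * ∫ x, UnitAddTorus.mFourier n x * k x)
      (∫ x, f x * k x) := by
  let K : L2 d := ContinuousMap.toLp 2 volume ℂ ⟨fun x => conj (k x), hk.star⟩
  have hK : ∀ g : L2 d, inner ℂ K g = ∫ x, g x * k x := fun g => by
    rw [L2.inner_def]
    refine integral_congr_ae ?_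
    filter_upwards [ContinuousMap.coeFn_toLp (𝕜 := ℂ) (p := 2) volume
      (⟨fun x => conj (k x), hk.star⟩ : C(Torus d, ℂ))] with x hx
    rw [RCLike.inner_apply, hx]
    simp
  have h := (innerSL ℂ K).hasSum ((fourierBasis d).hasSum_repr f)
  simp only [map_smul, innerSL_apply_apply, smul_eq_mul, hK] at h
  convert! h using 3 with n
  refine integral_congr_ae ?_
  filter_upwards [coeFn_fourierBasis n] with x hx
  rw [hx]

variable {V : Torus d → ℝ}

theorem memLp_potential_mul (hVm : Measurable V) (hVb : ∃ C : ℝ, ∀ x, |V x| ≤ C) (f : L2 d) :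
    MemLp (fun x => (V x : ℂ) * f x) 2 volume := by
  obtain ⟨C, hC⟩ := hVb
  refine (Lp.memLp f).of_le_mul (c := C)
    ((Complex.measurable_ofReal.comp hVm).aestronglyMeasurable.mul (Lp.aestronglyMeasurable f))
    (.of_forall fun x => ?_)
  rw [norm_mul, Complex.norm_real, Real.norm_eq_abs]
  exact mul_le_mul_of_nonneg_right (hC x) (norm_nonneg _)

/-- Multiplication by a bounded potential is a bounded symmetric operator on `L²(𝕋ᵈ)`. -/
theorem exists_potential_operator (hVm : Measurable V) (hVb : ∃ C : ℝ, ∀ x, |V x| ≤ C) :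
    ∃ B : L2 d →L[ℂ] L2 d, (∀ f, B f =ᵐ[volume] fun x => (V x : ℂ) * f x) ∧
      ∀ f g, inner ℂ (B f) g = inner ℂ f (B g) := by
  have hm := fun f => memLp_potential_mul hVm hVb (f := f)
  obtain ⟨C, hC⟩ := hVb
  let L : L2 d →ₗ[ℂ] L2 d :=
    { toFun := fun f => (hm f).toLp _
      map_add' := fun f g => by
        rw [← MemLp.toLp_add]
        refine MemLp.toLp_congr _ _ ?_
        filter_upwards [Lp.coeFn_add f g] with x hx
        rw [hx, Pi.add_apply, Pi.add_apply, mul_add]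
      map_smul' := fun c f => by
        rw [RingHom.id_apply, ← MemLp.toLp_const_smul]
        refine MemLp.toLp_congr _ _ ?_
        filter_upwards [Lp.coeFn_smul c f] with x hx
        rw [hx, Pi.smul_apply, Pi.smul_apply, smul_eq_mul, smul_eq_mul, mul_left_comm] }
  have hL : ∀ f, L f =ᵐ[volume] fun x => (V x : ℂ) * f x := fun f => (hm f).coeFn_toLp
  refine ⟨L.mkContinuous C fun f => ?_, hL, fun f g => ?_⟩
  · refine Lp.norm_le_mul_norm_of_ae_le_mul ?_
    filter_upwards [hL f] with x hx
    rw [hx, norm_mul, Complex.norm_real, Real.norm_eq_abs]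
    exact mul_le_mul_of_nonneg_right (hC x) (norm_nonneg _)
  · change inner ℂ (L f) g = inner ℂ f (L g)
    rw [L2.inner_def, L2.inner_def]
    refine integral_congr_ae ?_
    filter_upwards [hL f, hL g] with x hf hg
    rw [RCLike.inner_apply, RCLike.inner_apply, hf, hg, map_mul, Complex.conj_ofReal]
    ring

theorem hamiltonian_mFourier (n : Fin d → ℤ) (x : Torus d) :
    hamiltonian V (UnitAddTorus.mFourier n) x =
      (freq n + V x) * UnitAddTorus.mFourier n x := by
  rw [hamiltonian, laplacian_mFourier, add_mul]

/-- The graph of the Hamiltonian in terms of Fourier coefficients. -/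
theorem hamiltonianGraph_iff {B : L2 d →L[ℂ] L2 d}
    (hB : ∀ f, B f =ᵐ[volume] fun x => (V x : ℂ) * f x) (f g : L2 d) :
    HamiltonianGraph V f g ↔
      ∀ n, freq n * (fourierBasis d).repr f n = (fourierBasis d).repr (g - B f) n := by
  have hV : ∀ {η : Torus d → ℂ}, IsSmooth η → (∫ x, f x * hamiltonian V η x = ∫ x, g x * η x ↔
      ∫ x, f x * (-(1 / 2) * laplacian η x) = ∫ x, (g - B f : L2 d) x * η x) := fun {η} hη => by
    have hBf := integrable_L2_mul (B f) hη.continuous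
    have hΔ : Continuous fun x => -(1 / 2) * laplacian η x :=
      continuous_const.mul hη.laplacian.continuous
    have h1 : ∫ x, f x * hamiltonian V η x =
        (∫ x, f x * (-(1 / 2) * laplacian η x)) + ∫ x, B f x * η x := by
      rw [← integral_add (integrable_L2_mul f hΔ) hBf]
      refine integral_congr_ae ?_
      filter_upwards [hB f] with x hx
      rw [hx, hamiltonian]
      ring
    have h2 : ∫ x, (g - B f : L2 d) x * η x = (∫ x, g x * η x) - ∫ x, B f x * η x := by
      rw [← integral_sub (integrable_L2_mul g hη.continuous) hBf]
      refine integral_congr_ae ?_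
      filter_upwards [Lp.coeFn_sub g (B f)] with x hx
      rw [hx, Pi.sub_apply, sub_mul]
    rw [h1, h2, eq_sub_iff_add_eq]
  constructor
  · intro h n
    -- The pairing has no conjugate, so the `n`-th coefficient is read off by testing against mode
    -- `-n`.
    have h1 := (hV (isSmooth_mFourier (-n))).1 (h _ (isSmooth_mFourier (-n)))
    simp only [laplacian_mFourier, freq_neg] at h1
    rw [fourierBasis_repr, fourierBasis_repr, ← h1, ← integral_const_mul]
    congr 1
    ext x
    ring
  · intro h η hη
    rw [hV hη]
    have hΔ : Continuous fun x => -(1 / 2) * laplacian η x :=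
      continuous_const.mul hη.laplacian.continuous
    refine (hasSum_integral_mul_repr f hΔ).unique ?_
    convert! hasSum_integral_mul_repr (g - B f) hη.continuous using 2 with n
    have h1 : ∫ x, UnitAddTorus.mFourier n x * (-(1 / 2) * laplacian η x) =
        freq n * ∫ x, UnitAddTorus.mFourier n x * η x := by
      have h2 := integral_mul_laplacian (isSmooth_mFourier n) hη
      calc _ = -(1 / 2) * ∫ x, UnitAddTorus.mFourier n x * laplacian η x := by
            rw [← integral_const_mul]; congr 1; ext x; ring
        _ = ∫ x, freq n * (UnitAddTorus.mFourier n x * η x) := by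
            rw [h2, ← integral_const_mul]
            congr 1
            ext x
            rw [← mul_assoc, laplacian_mFourier, mul_assoc]
        _ = _ := integral_const_mul _ _
    rw [h1, ← h n]
    ring

/-- Smooth functions belong to the domain of the Hamiltonian, which acts on them classically. -/
theorem hamiltonianGraph_of_isSmooth (hVm : Measurable V) (hVb : ∃ C : ℝ, ∀ x, |V x| ≤ C)
    {u : Torus d → ℂ} (hu : IsSmooth u) {f g : L2 d} (hf : f =ᵐ[volume] u)
    (hg : g =ᵐ[volume] hamiltonian V u) : HamiltonianGraph V f g := fun η hη => by
  calc ∫ x, f x * hamiltonian V η x = ∫ x, u x * hamiltonian V η x :=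
        integral_congr_ae (hf.mono fun x hx => by simp only [hx])
    _ = ∫ x, hamiltonian V u x * η x := integral_mul_hamiltonian hVm hVb hu hη
    _ = ∫ x, g x * η x := integral_congr_ae (hg.mono fun x hx => by simp only [hx])

theorem IsUnitaryGroup.isStrongGroup {U : ℝ → (L2 d ≃ₗᵢ[ℂ] L2 d)} (hU : IsUnitaryGroup V U) :
    IsStrongGroup U := ⟨hU.map_zero, hU.map_add, hU.continuous⟩

theorem exists_isUnitaryGroup (hVm : Measurable V) (hVb : ∃ C : ℝ, ∀ x, |V x| ≤ C) :
    ∃ U : ℝ → (L2 d ≃ₗᵢ[ℂ] L2 d), IsUnitaryGroup V U := by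
  obtain ⟨B, hB, hsymm⟩ := exists_potential_operator hVm hVb
  obtain ⟨U, hU, hgen⟩ :=
    (isStrongGroup_diagonalUnitary (fourierBasis d) freq).exists_perturbation B hsymm
  refine ⟨U, hU.zero_apply, hU.add_apply, hU.continuous, fun f g => ?_⟩
  exact (hamiltonianGraph_iff hB f g).trans
    ((hasDerivAt_diagonalUnitary_iff _ _ f _).symm.trans (hgen f g).symm)

theorem IsUnitaryGroup.eq_of_graph {U W : ℝ → (L2 d ≃ₗᵢ[ℂ] L2 d)} (hU : IsUnitaryGroup V U)
    (hW : IsUnitaryGroup V W) {f g : L2 d} (h : HamiltonianGraph V f g) (t : ℝ) :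
    U t f = W t f := by
  have hU' := hU.isStrongGroup
  have hW' := hW.isStrongGroup
  have h1 : ∀ t, HasDerivAt (fun τ => U τ f) (-Complex.I • U t g) t := fun t => by
    rw [← map_smul]
    exact hU'.hasDerivAt_of_zero ((hU.generator f g).1 h) t
  have h2 : ∀ t, HasDerivAt (fun τ => W (-τ) (U τ f)) 0 t := fun t => by
    have h3 : HasDerivAt (fun τ => U τ (U t f)) (-Complex.I • U t g) 0 := by
      simp only [← hU.map_add]
      exact HasDerivAt.comp_add_const (f := fun τ => U τ f) 0 t (by simpa using h1 t)
    -- `h3` keeps the orbit `U t f` in the domain; as both groups have the same generator, the same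
    -- derivative holds for `W`.
    have h4 := (hW.generator _ _).1 ((hU.generator _ _).2 h3)
    have h5 := hW'.hasDerivAt_neg_apply (h1 t) h4
    rwa [sub_self, _root_.map_zero] at h5
  have h3 := is_const_of_deriv_eq_zero (fun t => (h2 t).differentiableAt)
    (fun t => (h2 t).deriv) t 0
  rw [neg_zero, hU.map_zero, hW.map_zero] at h3
  rw [← h3, hW'.apply_neg_self, h3]

/-- The Fourier modes lie in the domain and span a dense subspace, so agreement on them suffices. -/
theorem IsUnitaryGroup.unique (hVm : Measurable V) (hVb : ∃ C : ℝ, ∀ x, |V x| ≤ C)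
    {U W : ℝ → (L2 d ≃ₗᵢ[ℂ] L2 d)} (hU : IsUnitaryGroup V U) (hW : IsUnitaryGroup V W) :
    U = W := by
  obtain ⟨B, hB, -⟩ := exists_potential_operator hVm hVb
  funext t
  have hd : Dense (Submodule.span ℂ (range (fourierBasis d)) : Set (L2 d)) :=
    Submodule.dense_iff_topologicalClosure_eq_top.2 (fourierBasis d).dense_span
  have h : (U t).toContinuousLinearEquiv.toContinuousLinearMap =
      (W t).toContinuousLinearEquiv.toContinuousLinearMap := by
    refine ContinuousLinearMap.ext_on hd ?_
    rintro _ ⟨n, rfl⟩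
    refine hU.eq_of_graph hW (hamiltonianGraph_of_isSmooth hVm hVb (isSmooth_mFourier n)
      (coeFn_fourierBasis n)
      (g := (freq n : ℂ) • fourierBasis d n + B (fourierBasis d n)) ?_) t
    filter_upwards [Lp.coeFn_add ((freq n : ℂ) • fourierBasis d n) (B (fourierBasis d n)),
      Lp.coeFn_smul (freq n : ℂ) (fourierBasis d n), hB (fourierBasis d n),
      coeFn_fourierBasis n] with x h1 h2 h3 h4
    rw [h1, Pi.add_apply, h2, Pi.smul_apply, h3, h4, hamiltonian_mFourier, smul_eq_mul, add_mul]
  exact LinearIsometryEquiv.ext fun f => DFunLike.congr_fun h f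

end HamiltonianGroup

/-! ### The Lohe system as an ODE in a Hilbert space -/

section LoheSystem

open Filter Topology

variable {N : ℕ} {E : Type*} [NormedAddCommGroup E] [InnerProductSpace ℂ E]

/-- The scalar factor `(κ / N) ∑ₖ (⟨xⱼ | xₖ⟩ - ⟨xₖ | xⱼ⟩)` of the rotational coupling. -/
def loheRate (κ : ℝ) (x : Fin N → E) (j : Fin N) : ℂ :=
  (κ / N : ℂ) * ∑ k, (inner ℂ (x j) (x k) - inner ℂ (x k) (x j))

/-- The vector field of the Lohe system with rotational couplings in a Hilbert space. -/
def loheField (κ : ℝ) (x : Fin N → E) (j : Fin N) : E := loheRate κ x j • x j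

theorem continuous_loheField (κ : ℝ) : Continuous (loheField κ : (Fin N → E) → Fin N → E) := by
  unfold loheField loheRate
  fun_prop

theorem norm_inner_sub_inner_le {R δ : ℝ} {a b a' b' : E} (ha : ‖a‖ ≤ R) (hb' : ‖b'‖ ≤ R)
    (ha' : ‖a - a'‖ ≤ δ) (hb : ‖b - b'‖ ≤ δ) : ‖inner ℂ a b - inner ℂ a' b'‖ ≤ 2 * R * δ := by
  have hR : 0 ≤ R := (norm_nonneg _).trans ha
  have hδ : 0 ≤ δ := (norm_nonneg _).trans hb
  have h : inner ℂ a b - inner ℂ a' b' = inner ℂ a (b - b') + inner ℂ (a - a') b' := by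
    rw [inner_sub_right, inner_sub_left]; ring
  calc _ ≤ ‖a‖ * ‖b - b'‖ + ‖a - a'‖ * ‖b'‖ := by
        rw [h]
        exact (norm_add_le _ _).trans (add_le_add (norm_inner_le_norm _ _)
          (norm_inner_le_norm _ _))
    _ ≤ R * δ + δ * R := by gcongr
    _ = _ := by ring

theorem lipschitzOnWith_loheField (κ : ℝ) (R : ℝ) :
    ∃ K, LipschitzOnWith K (loheField κ : (Fin N → E) → Fin N → E) (Metric.closedBall 0 R) := by
  rcases lt_or_ge R 0 with hR | hR
  · exact ⟨0, by simp [Metric.closedBall_eq_empty.2 hR]⟩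
  have hM : 0 ≤ ‖(κ / N : ℂ)‖ := norm_nonneg _
  -- `6 = 2 + 4`: the bound `2R²` on each summand of the rate, plus its variation `4Rδ` times `‖y j‖
  -- ≤ R`.
  refine ⟨(‖(κ / N : ℂ)‖ * (N * (6 * R ^ 2))).toNNReal, .of_dist_le_mul fun x hx y hy => ?_⟩
  rw [mem_closedBall_zero_iff] at hx hy
  rw [dist_eq_norm, dist_eq_norm, Real.coe_toNNReal _ (by positivity)]
  set δ := ‖x - y‖
  have hδ : 0 ≤ δ := norm_nonneg _
  have hxj : ∀ j, ‖x j‖ ≤ R := fun j => (norm_le_pi_norm x j).trans hx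
  have hyj : ∀ j, ‖y j‖ ≤ R := fun j => (norm_le_pi_norm y j).trans hy
  have hd : ∀ j, ‖x j - y j‖ ≤ δ := fun j => norm_le_pi_norm (x - y) j
  have hrate : ∀ j, ‖loheRate κ x j‖ ≤ ‖(κ / N : ℂ)‖ * (N * (2 * R ^ 2)) := fun j => by
    rw [loheRate, norm_mul]
    refine mul_le_mul_of_nonneg_left ?_ hM
    refine (norm_sum_le_of_le (n := fun _ => 2 * R ^ 2) _ fun k _ => ?_).trans (by simp)
    have h1 : ∀ i l, ‖inner ℂ (x i) (x l)‖ ≤ R ^ 2 := fun i l =>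
      (norm_inner_le_norm _ _).trans (by
        rw [sq]; exact mul_le_mul (hxj i) (hxj l) (norm_nonneg _) hR)
    exact (norm_sub_le _ _).trans ((add_le_add (h1 _ _) (h1 _ _)).trans_eq (by ring))
  have hrate' : ∀ j, ‖loheRate κ x j - loheRate κ y j‖ ≤ ‖(κ / N : ℂ)‖ * (N * (4 * R * δ)) :=
    fun j => by
      rw [loheRate, loheRate, ← mul_sub, norm_mul, ← Finset.sum_sub_distrib]
      refine mul_le_mul_of_nonneg_left ?_ hM
      refine (norm_sum_le_of_le (n := fun _ => 4 * R * δ) _ fun k _ => ?_).trans (by simp)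
      rw [sub_sub_sub_comm]
      exact (norm_sub_le _ _).trans ((add_le_add
        (norm_inner_sub_inner_le (hxj _) (hyj _) (hd _) (hd _))
        (norm_inner_sub_inner_le (hxj _) (hyj _) (hd _) (hd _))).trans_eq (by ring))
  refine (pi_norm_le_iff_of_nonneg (by positivity)).2 fun j => ?_
  have h : (loheField κ x - loheField κ y) j =
      loheRate κ x j • (x j - y j) + (loheRate κ x j - loheRate κ y j) • y j := by
    simp only [loheField, Pi.sub_apply, smul_sub, sub_smul]
    abel
  calc _ ≤ ‖loheRate κ x j‖ * ‖x j - y j‖ + ‖loheRate κ x j - loheRate κ y j‖ * ‖y j‖ := by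
        rw [h, ← norm_smul, ← norm_smul]
        exact norm_add_le _ _
    _ ≤ ‖(κ / N : ℂ)‖ * (N * (2 * R ^ 2)) * δ + ‖(κ / N : ℂ)‖ * (N * (4 * R * δ)) * R := by
        gcongr
        exacts [hrate j, hd j, hrate' j, hyj j]
    _ = _ := by ring

/-- Uniqueness of solutions of the Lohe system that are continuous up to the initial time. -/
theorem loheField_solution_unique (κ : ℝ) {x y : ℝ → Fin N → E} (hx : Continuous x)
    (hy : Continuous y) (hx' : ∀ t > 0, HasDerivAt x (loheField κ (x t)) t)
    (hy' : ∀ t > 0, HasDerivAt y (loheField κ (y t)) t) (h0 : x 0 = y 0) {t : ℝ} (ht : 0 ≤ t) :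
    x t = y t := by
  have hright : ∀ z : ℝ → Fin N → E, Continuous z →
      (∀ t > 0, HasDerivAt z (loheField κ (z t)) t) →
      ∀ s ≥ 0, HasDerivWithinAt z (loheField κ (z s)) (Ici s) s := fun z hz hz' s hs => by
    rcases hs.eq_or_lt with rfl | hs
    -- The equation is given only for positive times; at `0` the right derivative is the limit of
    -- the derivatives, by continuity of the field.
    · refine hasDerivWithinAt_Ici_of_tendsto_deriv (s := Ioi 0)
        (fun s hs => (hz' s hs).differentiableAt.differentiableWithinAt)
        hz.continuousWithinAt self_mem_nhdsWithin ?_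
      refine ((((continuous_loheField κ).comp hz).tendsto 0).mono_left
        nhdsWithin_le_nhds).congr' ?_
      filter_upwards [self_mem_nhdsWithin] with s hs using (hz' s hs).deriv.symm
    · exact (hz' s hs).hasDerivWithinAt
  obtain ⟨R₁, hR₁⟩ := isCompact_Icc.exists_bound_of_continuousOn (s := Icc 0 t) hx.continuousOn
  obtain ⟨R₂, hR₂⟩ := isCompact_Icc.exists_bound_of_continuousOn (s := Icc 0 t) hy.continuousOn
  obtain ⟨K, hK⟩ := lipschitzOnWith_loheField (N := N) (E := E) κ (max R₁ R₂)
  exact ODE_solution_unique_of_mem_Icc_right (v := fun _ => loheField κ)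
    (s := fun _ => Metric.closedBall 0 (max R₁ R₂)) (fun _ _ => hK) hx.continuousOn
    (fun s hs => hright x hx hx' s hs.1)
    (fun s hs => mem_closedBall_zero_iff.2 ((hR₁ s ⟨hs.1, hs.2.le⟩).trans (le_max_left _ _)))
    hy.continuousOn (fun s hs => hright y hy hy' s hs.1)
    (fun s hs => mem_closedBall_zero_iff.2 ((hR₂ s ⟨hs.1, hs.2.le⟩).trans (le_max_right _ _)))
    h0 (right_mem_Icc.2 ht)

end LoheSystem

/-! ### Space-time smooth functions as curves in `C(𝕋ᵈ)` -/

section Curves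

open Filter Topology

variable {d : ℕ} {u : ℝ → Torus d → ℂ}

/-- The curve in `C(𝕋ᵈ)` defined by a function continuous on `[0, ∞) × 𝕋ᵈ`, extended to negative
times by its initial value. -/
def supCurve (hu : ContinuousOn (fun p : ℝ × Torus d => u p.1 p.2) (Ici 0 ×ˢ univ)) :
    C(ℝ, C(Torus d, ℂ)) :=
  ContinuousMap.curry ⟨fun p : ℝ × Torus d => u (max p.1 0) p.2,
    hu.comp_continuous (f := fun p : ℝ × Torus d => (max p.1 0, p.2)) (by fun_prop)
      fun p => ⟨le_max_right p.1 0, mem_univ _⟩⟩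

theorem supCurve_apply (hu : ContinuousOn (fun p : ℝ × Torus d => u p.1 p.2) (Ici 0 ×ˢ univ))
    {t : ℝ} (ht : 0 ≤ t) (x : Torus d) : supCurve hu t x = u t x := by
  change u (max t 0) x = u t x
  rw [max_eq_left ht]

theorem differentiableAt_lift
    (hu' : ContDiffOn ℝ ∞ (fun p : ℝ × (Fin d → ℝ) => u p.1 (proj p.2)) (Ioi 0 ×ˢ univ))
    {t : ℝ} (ht : 0 < t) (y : Fin d → ℝ) :
    DifferentiableAt ℝ (fun p : ℝ × (Fin d → ℝ) => u p.1 (proj p.2)) (t, y) :=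
  (hu'.differentiableOn (by simp)).differentiableAt
    ((isOpen_Ioi.prod isOpen_univ).mem_nhds ⟨ht, mem_univ _⟩)

theorem isSmooth_slice
    (hu' : ContDiffOn ℝ ∞ (fun p : ℝ × (Fin d → ℝ) => u p.1 (proj p.2)) (Ioi 0 ×ˢ univ))
    {t : ℝ} (ht : 0 < t) : IsSmooth (u t) :=
  contDiffOn_univ.1 (ContDiffOn.comp (t := Ioi (0 : ℝ) ×ˢ univ)
    (f := fun y : Fin d → ℝ => (t, y)) hu' (by fun_prop) fun y _ => ⟨ht, mem_univ _⟩)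

theorem hasDerivAt_lift
    (hu' : ContDiffOn ℝ ∞ (fun p : ℝ × (Fin d → ℝ) => u p.1 (proj p.2)) (Ioi 0 ×ˢ univ))
    {t : ℝ} (ht : 0 < t) (y : Fin d → ℝ) :
    HasDerivAt (fun s => u s (proj y))
      (fderiv ℝ (fun p : ℝ × (Fin d → ℝ) => u p.1 (proj p.2)) (t, y) (1, 0)) t :=
  (differentiableAt_lift hu' ht y).hasFDerivAt.comp_hasDerivAt (f := fun s => (s, y)) t
    ((hasDerivAt_id' t).prodMk (hasDerivAt_const t y))

theorem hasDerivAt_time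
    (hu' : ContDiffOn ℝ ∞ (fun p : ℝ × (Fin d → ℝ) => u p.1 (proj p.2)) (Ioi 0 ×ˢ univ))
    {t : ℝ} (ht : 0 < t) (x : Torus d) :
    HasDerivAt (fun s => u s x) (deriv (fun s => u s x) t) t := by
  obtain ⟨y, rfl⟩ := isOpenQuotientMap_proj.surjective x
  exact (hasDerivAt_lift hu' ht y).differentiableAt.hasDerivAt

theorem continuousOn_time_deriv
    (hu' : ContDiffOn ℝ ∞ (fun p : ℝ × (Fin d → ℝ) => u p.1 (proj p.2)) (Ioi 0 ×ˢ univ)) :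
    ContinuousOn (fun p : ℝ × Torus d => deriv (fun s => u s p.2) p.1) (Ioi 0 ×ˢ univ) := by
  have hopen : IsOpen (Ioi (0 : ℝ) ×ˢ (univ : Set (Fin d → ℝ))) := isOpen_Ioi.prod isOpen_univ
  rintro ⟨t, x⟩ ⟨ht, -⟩
  obtain ⟨y, rfl⟩ := isOpenQuotientMap_proj.surjective x
  refine ContinuousAt.continuousWithinAt ?_
  refine ((IsOpenQuotientMap.id (X := ℝ)).prodMap
    (isOpenQuotientMap_proj (d := d))).continuousAt_comp_iff (x := (t, y)) |>.1 ?_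
  have h := (hu'.continuousOn_fderiv_of_isOpen hopen (by simp)).clm_apply
    (continuousOn_const (c := ((1, 0) : ℝ × (Fin d → ℝ))))
  refine (h.continuousAt (hopen.mem_nhds ⟨ht, mem_univ _⟩)).congr ?_
  filter_upwards [hopen.mem_nhds ⟨ht, mem_univ y⟩] with p hp
  exact (hasDerivAt_lift hu' hp.1 p.2).deriv.symm

/-- A curve that is smooth in space-time is differentiable as a curve in `C(𝕋ᵈ)`. -/
theorem exists_hasDerivAt_supCurve
    (hu' : ContDiffOn ℝ ∞ (fun p : ℝ × (Fin d → ℝ) => u p.1 (proj p.2)) (Ioi 0 ×ˢ univ))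
    (hu : ContinuousOn (fun p : ℝ × Torus d => u p.1 p.2) (Ici 0 ×ˢ univ)) {t : ℝ} (ht : 0 < t) :
    ∃ G : C(Torus d, ℂ), (∀ x, G x = deriv (fun s => u s x) t) ∧ HasDerivAt (supCurve hu) G t := by
  -- Clamping time at `t / 2` gives a globally continuous curve of time derivatives that is the true
  -- one near `t`. The fundamental theorem of calculus is then applied in `C(𝕋ᵈ)` and checked
  -- pointwise.
  have hε : 0 < t / 2 := half_pos ht
  let G : C(ℝ, C(Torus d, ℂ)) := ContinuousMap.curry
    ⟨fun p : ℝ × Torus d => deriv (fun s => u s p.2) (max p.1 (t / 2)),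
      (continuousOn_time_deriv hu').comp_continuous
        (f := fun p : ℝ × Torus d => (max p.1 (t / 2), p.2)) (by fun_prop)
        fun p => ⟨lt_max_of_lt_right hε, mem_univ _⟩⟩
  have hG : ∀ s ≥ t / 2, ∀ x, G s x = deriv (fun s => u s x) s := fun s hs x => by
    change deriv _ (max s (t / 2)) = _
    rw [max_eq_left hs]
  refine ⟨G t, hG t (by linarith), ?_⟩
  have h1 : HasDerivAt (fun s => supCurve hu t + ∫ τ in t..s, G τ) (G t) t :=
    (intervalIntegral.integral_hasDerivAt_right (G.continuous.intervalIntegrable _ _)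
      (G.continuous.stronglyMeasurableAtFilter _ _) G.continuous.continuousAt).const_add _
  refine h1.congr_of_eventuallyEq ?_
  filter_upwards [Ioi_mem_nhds (half_lt_self ht)] with s hs
  have hs' : t / 2 < s := hs
  ext x
  have hle : ∀ τ ∈ uIcc t s, t / 2 ≤ τ := fun τ hτ =>
    (le_min (by linarith) hs'.le).trans hτ.1
  have h2 : (∫ τ in t..s, G τ) x = ∫ τ in t..s, G τ x :=
    ((ContinuousMap.evalCLM ℝ x).intervalIntegral_comp_comm
      (G.continuous.intervalIntegrable t s)).symm
  have h3 : ∫ τ in t..s, G τ x = u s x - u t x := by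
    refine intervalIntegral.integral_eq_sub_of_hasDerivAt (f := fun τ => u τ x)
      (fun τ hτ => ?_) ?_
    · rw [hG τ (hle τ hτ)]
      exact hasDerivAt_time hu' (hε.trans_le (hle τ hτ)) x
    · exact (((ContinuousMap.evalCLM ℝ x).continuous.comp G.continuous)).intervalIntegrable _ _
  rw [ContinuousMap.add_apply, h2, h3, supCurve_apply hu ht.le, supCurve_apply hu (hε.trans hs').le,
    add_sub_cancel]

end Curves

/-! ### The interaction picture -/

section Main

variable {d N : ℕ}

/-- A continuous function as an element of `L²(𝕋ᵈ)`. -/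
abbrev toL2 : C(Torus d, ℂ) →L[ℂ] L2 d := ContinuousMap.toLp 2 volume ℂ

theorem coeFn_toL2 (f : C(Torus d, ℂ)) : toL2 f =ᵐ[volume] f := ContinuousMap.coeFn_toLp volume f

theorem inner_toL2 (f g : C(Torus d, ℂ)) : inner ℂ (toL2 f) (toL2 g) = braket f g := by
  rw [L2.inner_def]
  refine integral_congr_ae ?_
  filter_upwards [coeFn_toL2 f, coeFn_toL2 g] with x hf hg
  rw [RCLike.inner_apply, hf, hg, mul_comm]

theorem coupling_eq (κ : ℝ) (f : Fin N → C(Torus d, ℂ)) (j : Fin N) (x : Torus d) :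
    coupling κ (fun k => f k) j x = Complex.I * loheRate κ (fun k => toL2 (f k)) j * f j x := by
  simp only [coupling, loheRate, inner_toL2, ← Finset.sum_mul]
  ring

theorem IsGlobalSmooth.toLp_eq {ψ : Fin N → ℝ → Torus d → ℂ} (hψ : IsGlobalSmooth ψ) (j : Fin N)
    {t : ℝ} (ht : 0 ≤ t) :
    ∃ h : MemLp (ψ j t) 2 volume, h.toLp (ψ j t) = toL2 (supCurve (hψ.continuousOn j) t) := by
  have he : ψ j t = supCurve (hψ.continuousOn j) t :=
    funext fun x => (supCurve_apply (hψ.continuousOn j) ht x).symm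
  have h := (Lp.memLp (toL2 (supCurve (hψ.continuousOn j) t))).ae_eq (coeFn_toL2 _)
  rw [← he] at h
  refine ⟨h, Lp.ext (h.coeFn_toLp.trans ?_)⟩
  rw [he]
  exact (coeFn_toL2 _).symm

/-- The `L²`-valued curve of a space-time smooth function is differentiable. -/
theorem IsGlobalSmooth.exists_hasDerivAt {ψ : Fin N → ℝ → Torus d → ℂ} (hψ : IsGlobalSmooth ψ)
    (j : Fin N) {t : ℝ} (ht : 0 < t) :
    ∃ G : C(Torus d, ℂ), (∀ x, G x = deriv (fun s => ψ j s x) t) ∧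
      HasDerivAt (fun t => toL2 (supCurve (hψ.continuousOn j) t)) (toL2 G) t := by
  obtain ⟨G, hG, hd⟩ := exists_hasDerivAt_supCurve (hψ.contDiffOn j) (hψ.continuousOn j) ht
  exact ⟨G, hG, (toL2.restrictScalars ℝ).hasFDerivAt.comp_hasDerivAt t hd⟩

theorem IsGlobalSmooth.coupling_eq {ψ : Fin N → ℝ → Torus d → ℂ} (hψ : IsGlobalSmooth ψ) (κ : ℝ)
    (j : Fin N) {t : ℝ} (ht : 0 ≤ t) (x : Torus d) :
    coupling κ (fun k => ψ k t) j x =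
      Complex.I * loheRate κ (fun k => toL2 (supCurve (hψ.continuousOn k) t)) j *
        supCurve (hψ.continuousOn j) t x := by
  rw [← SchrodingerLohe.coupling_eq κ (fun k => supCurve (hψ.continuousOn k) t)]
  congr 1
  exact funext fun k => funext fun x => (supCurve_apply (hψ.continuousOn k) ht x).symm

theorem IsNonlinearSolution.hasDerivAt {κ : ℝ} {ψ0 : Fin N → Torus d → ℂ}
    {φ : Fin N → ℝ → Torus d → ℂ} (hφ : IsNonlinearSolution κ ψ0 φ) {t : ℝ} (ht : 0 < t) :
    HasDerivAt (fun t j => toL2 (supCurve (hφ.smooth.continuousOn j) t))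
      (loheField κ fun j => toL2 (supCurve (hφ.smooth.continuousOn j) t)) t := by
  refine hasDerivAt_pi.2 fun j => ?_
  obtain ⟨G, hG, hd⟩ := hφ.smooth.exists_hasDerivAt j ht
  convert! hd using 1
  rw [loheField, ← map_smul]
  congr 1
  ext x
  refine mul_left_cancel₀ Complex.I_ne_zero ?_
  rw [hG, hφ.equation j t ht x, hφ.smooth.coupling_eq κ j ht.le, ContinuousMap.smul_apply,
    smul_eq_mul, mul_assoc]

theorem loheRate_map {E : Type*} [NormedAddCommGroup E] [InnerProductSpace ℂ E]
    (κ : ℝ) (W : E ≃ₗᵢ[ℂ] E) (x : Fin N → E) (j : Fin N) :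
    loheRate κ (fun k => W (x k)) j = loheRate κ x j := by
  simp only [loheRate, LinearIsometryEquiv.inner_map_map]

/-- In the interaction picture, a solution of the Schrödinger–Lohe model solves the Lohe system
without Hamiltonian. -/
theorem IsSolution.hasDerivAt {V : Torus d → ℝ} (hVm : Measurable V)
    (hVb : ∃ C : ℝ, ∀ x, |V x| ≤ C) {U : ℝ → (L2 d ≃ₗᵢ[ℂ] L2 d)} (hU : IsUnitaryGroup V U)
    {κ : ℝ} {ψ0 : Fin N → Torus d → ℂ} {ψ : Fin N → ℝ → Torus d → ℂ}
    (hψ : IsSolution V κ ψ0 ψ) {t : ℝ} (ht : 0 < t) :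
    HasDerivAt (fun t j => U (-t) (toL2 (supCurve (hψ.smooth.continuousOn j) t)))
      (loheField κ fun j => U (-t) (toL2 (supCurve (hψ.smooth.continuousOn j) t))) t := by
  refine hasDerivAt_pi.2 fun j => ?_
  obtain ⟨G, hG, hd⟩ := hψ.smooth.exists_hasDerivAt j ht
  let u := supCurve (hψ.smooth.continuousOn j) t
  let a := loheRate κ (fun k => toL2 (supCurve (hψ.smooth.continuousOn k) t)) j
  -- This is `H ψⱼ` solved from the equation. It is continuous even though `V` need not be.
  let g : C(Torus d, ℂ) := Complex.I • (G - a • u)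
  have hgraph : HamiltonianGraph V (toL2 u) (toL2 g) := by
    refine hamiltonianGraph_of_isSmooth hVm hVb (isSmooth_slice (hψ.smooth.contDiffOn j) ht)
      ((coeFn_toL2 u).trans (.of_forall fun x => supCurve_apply _ ht.le x))
      ((coeFn_toL2 g).trans (.of_forall fun x => ?_))
    have h1 := hψ.equation j t ht x
    rw [hψ.smooth.coupling_eq κ j ht.le, ← hG] at h1
    change Complex.I * (G x - a * u x) = _
    rw [mul_sub, h1, ← mul_assoc, add_sub_cancel_right]
  have h2 := hU.isStrongGroup.hasDerivAt_neg_apply hd ((hU.generator _ _).1 hgraph)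
  have h3 : toL2 G - -Complex.I • toL2 g = a • toL2 u := by
    simp only [g, map_smul, map_sub, smul_smul, neg_mul, Complex.I_mul_I, neg_neg, one_smul,
      sub_sub_cancel]
  rw [h3, map_smul] at h2
  rw [loheField, loheRate_map κ (U (-t))]
  exact h2

end Main

end SchrodingerLohe

end

theorem theorem3p2 {d N : ℕ} (V : SchrodingerLohe.Torus d → ℝ) (hVm : Measurable V)
    (hVb : ∃ C : ℝ, ∀ x, |V x| ≤ C) :
    (∃! U : ℝ → (SchrodingerLohe.L2 d ≃ₗᵢ[ℂ] SchrodingerLohe.L2 d),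
      SchrodingerLohe.IsUnitaryGroup V U) ∧
    ∀ U : ℝ → (SchrodingerLohe.L2 d ≃ₗᵢ[ℂ] SchrodingerLohe.L2 d),
      SchrodingerLohe.IsUnitaryGroup V U →
      ∀ (κ : ℝ) (ψ0 : Fin N → SchrodingerLohe.Torus d → ℂ)
        (ψ φ : Fin N → ℝ → SchrodingerLohe.Torus d → ℂ),
        SchrodingerLohe.IsSolution V κ ψ0 ψ →
        SchrodingerLohe.IsNonlinearSolution κ ψ0 φ →
        ∀ j, ∀ t : ℝ, 0 ≤ t →
          ∃ (hψ : MemLp (ψ j t) 2 volume) (hφ : MemLp (φ j t) 2 volume),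
            hψ.toLp (ψ j t) = U t (hφ.toLp (φ j t)) := by
  open SchrodingerLohe in
  refine ⟨?_, fun U hU κ ψ0 ψ φ hψ hφ j t ht => ?_⟩
  · obtain ⟨U, hU⟩ := exists_isUnitaryGroup hVm hVb
    exact ⟨U, hU, fun W hW => hW.unique hVm hVb hU⟩
  · obtain ⟨h1, e1⟩ := hψ.smooth.toLp_eq j ht
    obtain ⟨h2, e2⟩ := hφ.smooth.toLp_eq j ht
    refine ⟨h1, h2, ?_⟩
    have hinit : ∀ k, supCurve (hψ.smooth.continuousOn k) 0 =
        supCurve (hφ.smooth.continuousOn k) 0 := fun k => ContinuousMap.ext fun x => by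
      rw [supCurve_apply _ le_rfl, supCurve_apply _ le_rfl, hψ.initial, hφ.initial]
    have key := loheField_solution_unique κ
      (x := fun t j => U (-t) (toL2 (supCurve (hψ.smooth.continuousOn j) t)))
      (y := fun t j => toL2 (supCurve (hφ.smooth.continuousOn j) t))
      (continuous_pi fun k => hU.isStrongGroup.continuous_uncurry.comp
        (continuous_neg.prodMk (toL2.continuous.comp (supCurve _).continuous)))
      (continuous_pi fun k => toL2.continuous.comp (supCurve _).continuous)
      (fun s hs => hψ.hasDerivAt hVm hVb hU hs) (fun s hs => hφ.hasDerivAt hs)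
      (funext fun k => by rw [neg_zero, hU.map_zero, hinit]) ht
    rw [e1, e2, ← congrFun key j, hU.isStrongGroup.apply_neg_self]
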